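/- All Hilbert spaces are complex and finite-dimensional, and $\log$ is to base $2$. Let $\mathcal N,\mathcal M: A'\to B$ be quantum channels, i.e. completely positive trace-preserving linear maps from the operators on $A'$ to the operators on $B$, and let $d_B=\dim B$. For a linear map $\Phi$ from the operators on $A'$ to the operators on $B$ let $$\|\Phi\|_\diamond=\sup\{\|(\mathcal I_R\otimes\Phi)(X)\|_1 : R \text{ a reference system},\ X\in\mathcal B(R\otimes A'),\ \|X\|_1=1\},\qquad \|X\|_1=\operatorname{Tr}\sqrt{X^\dagger X}.$$ Let $0\le\epsilon\le 1$ and suppose $\|\mathcal N-\mathcal M\|_\diamond\le\epsilon$. Then for every auxiliary reference system $A$, every integer $n\ge 0$ and every state $\phi$ (positive semidefinite operator of trace one) on $A\otimes A'^{\otimes n}$, $$\Bigl|S\bigl((\mathcal I_A\otimes\mathcal N^{\otimes n})(\phi)\bigr)-S\bigl((\mathcal I_A\otimes\mathcal M^{\otimes n})(\phi)\bigr)\Bigr|\le n\bigl(4\epsilon\log d_B+2H(\epsilon)\bigr),$$ where $S(\rho)=-\operatorname{Tr}\rho\log\rho$ is the von Neumann entropy and $H(\epsilon)=-\epsilon\log\epsilon-(1-\epsilon)\log(1-\epsilon)$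 is the binary Shannon entropy, with $0\log 0=0$. -/

import Mathlib

open scoped ENNReal ComplexOrder

/-! A finite-dimensional system with a chosen orthonormal basis indexed by a finite type `α` has
Hilbert space `ℂ^α` and operators `Matrix α α ℂ`.  A composite of systems `α` and `β` is indexed by
`α × β`, and `n` copies of `α` are indexed by `Fin n → α`. -/

namespace Quantum

variable {α β : Type*} [Fintype α] [DecidableEq α] [Fintype β] [DecidableEq β]

/-- A quantum state: a positive semidefinite operator with unit trace. -/
structure IsState (ρ : Matrix α α ℂ) : Prop where
  posSemidef : ρ.PosSemidef
  trace_eq_one : ρ.trace = 1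

/-- The map `I ⊗ Φ` with a reference system `R`: the map `Φ` is applied to every block
`⟨r| X |s⟩` of an operator `X` on `R ⊗ α`. -/
def idTensor (R : Type*) (Φ : Matrix α α ℂ →ₗ[ℂ] Matrix β β ℂ) :
    Matrix (R × α) (R × α) ℂ →ₗ[ℂ] Matrix (R × β) (R × β) ℂ where
  toFun X := Matrix.of fun p q => Φ (Matrix.of fun i j => X (p.1, i) (q.1, j)) p.2 q.2
  map_add' X Y := by
    ext p q
    exact congrFun (congrFun (Φ.map_add (Matrix.of fun i j => X (p.1, i) (q.1, j))
      (Matrix.of fun i j => Y (p.1, i) (q.1, j))) p.2) q.2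
  map_smul' c X := by
    ext p q
    exact congrFun (congrFun (Φ.map_smul c (Matrix.of fun i j => X (p.1, i) (q.1, j))) p.2) q.2

/-- `Φ` is completely positive: `I ⊗ Φ` preserves positive semidefiniteness for every
finite-dimensional reference system. -/
def IsCompletelyPositive (Φ : Matrix α α ℂ →ₗ[ℂ] Matrix β β ℂ) : Prop :=
  ∀ (k : ℕ) (X : Matrix (Fin k × α) (Fin k × α) ℂ),
    X.PosSemidef → (idTensor (Fin k) Φ X).PosSemidef

/-- A quantum channel: a completely positive, trace-preserving linear map. -/
structure IsChannel (Φ : Matrix α α ℂ →ₗ[ℂ] Matrix β β ℂ) : Prop where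
  completelyPositive : IsCompletelyPositive Φ
  trace_map : ∀ X, (Φ X).trace = X.trace

/-- The `n`-fold tensor power `Φ^{⊗ n}`, given on the matrix units
`|i₁⟩⟨j₁| ⊗ ⋯ ⊗ |iₙ⟩⟨jₙ|` by `Φ(|i₁⟩⟨j₁|) ⊗ ⋯ ⊗ Φ(|iₙ⟩⟨jₙ|)` and extended linearly. -/
def tensorPow (n : ℕ) (Φ : Matrix α α ℂ →ₗ[ℂ] Matrix β β ℂ) :
    Matrix (Fin n → α) (Fin n → α) ℂ →ₗ[ℂ] Matrix (Fin n → β) (Fin n → β) ℂ where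
  toFun X := Matrix.of fun x y =>
    ∑ i : Fin n → α, ∑ j : Fin n → α,
      X i j * ∏ k : Fin n, Φ (Matrix.single (i k) (j k) 1) (x k) (y k)
  map_add' X Y := by
    ext x y
    simp [add_mul, Finset.sum_add_distrib]
  map_smul' c X := by
    ext x y
    simp [Finset.mul_sum, mul_assoc]

/-- The trace norm `‖X‖₁ = Tr |X|`, where `|X| = √(X† X)`. -/
noncomputable def traceNorm (X : Matrix α α ℂ) : ℝ :=
  (cfc Real.sqrt (X.conjTranspose * X)).trace.re

/-- The diamond norm: the supremum of `‖(I ⊗ Φ)(X)‖₁` over all finite-dimensional reference systems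
and all operators `X` with `‖X‖₁ = 1`. -/
noncomputable def diamondNorm (Φ : Matrix α α ℂ →ₗ[ℂ] Matrix β β ℂ) : ℝ≥0∞ :=
  ⨆ (k : ℕ) (X : Matrix (Fin k × α) (Fin k × α) ℂ) (_ : traceNorm X = 1),
    ENNReal.ofReal (traceNorm (idTensor (Fin k) Φ X))

/-- The von Neumann entropy `S(ρ) = -Tr ρ log₂ ρ`, in bits. -/
noncomputable def entropy (ρ : Matrix α α ℂ) : ℝ :=
  -(ρ * cfc (Real.logb 2) ρ).trace.re

/-- The binary Shannon entropy `H(p) = -p log₂ p - (1 - p) log₂ (1 - p)`, in bits. -/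
noncomputable def binaryEntropy (p : ℝ) : ℝ :=
  -p * Real.logb 2 p - (1 - p) * Real.logb 2 (1 - p)

end Quantum

namespace Quantum

open Matrix Real

set_option linter.unusedSectionVars false

variable {α β : Type*} [Fintype α] [DecidableEq α] [Fintype β] [DecidableEq β]

/-! The factors `N` are exchanged for `M` one at a time, so the bound is `n` times the cost of one
exchange (`abs_spectralEntropy_idTensor_tensorPow_sub_le`). An exchange compares two states that
agree after tracing out a single output `B`, because both channels preserve the trace. Their trace
distance is at most `ε` by the diamond norm, however large the remaining systems are.

The cost is the Alicki–Fannes estimate `spectralEntropy_sub_le`. States with a common marginal have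
entropies within `2 log d_B`, by subadditivity and Araki–Lieb. If they are also `ε`-close, each is
completed with weight `ε` to one common mixture. Concavity, and its converse up to `H(ε)`, reduce
the difference to that of the completing states, which again share a marginal: `(1 - ε) Δ ≤ 2 ε log
d_B + H(ε)`.

All entropy inequalities come from Jensen for `negMulLog`, together with the equality of the
entropies of `V * W` and `W * V`. -/

/-! ### Entropy as a function of the spectrum -/

/-- The von Neumann entropy in nats, read off from the roots of the characteristic polynomial. -/
noncomputable def spectralEntropy (ρ : Matrix α α ℂ) : ℝ :=
  (ρ.charpoly.roots.map fun z => negMulLog z.re).sum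

theorem spectralEntropy_eq_sum_eigenvalues {ρ : Matrix α α ℂ} (h : ρ.IsHermitian) :
    spectralEntropy ρ = ∑ i, negMulLog (h.eigenvalues i) := by
  simp [spectralEntropy, h.roots_charpoly_eq_eigenvalues, Finset.sum_map_val]

theorem _root_.Matrix.IsHermitian.exists_unitary_diagonal {ρ : Matrix α α ℂ}
    (h : ρ.IsHermitian) :
    ∃ U : Matrix α α ℂ, U * Uᴴ = 1 ∧ Uᴴ * U = 1 ∧
      ρ = U * diagonal (fun i => (h.eigenvalues i : ℂ)) * Uᴴ ∧
      ∀ f : ℝ → ℝ, cfc f ρ = U * diagonal (fun i => (f (h.eigenvalues i) : ℂ)) * Uᴴ := by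
  refine ⟨h.eigenvectorUnitary, ?_, ?_, ?_, fun f => ?_⟩
  · exact Unitary.coe_mul_star_self _
  · exact Unitary.coe_star_mul_self _
  · conv_lhs => rw [h.spectral_theorem, Unitary.conjStarAlgAut_apply]
    rfl
  · rw [h.cfc_eq, IsHermitian.cfc, Unitary.conjStarAlgAut_apply]
    rfl

theorem entropy_eq_spectralEntropy_div {ρ : Matrix α α ℂ} (h : ρ.IsHermitian) :
    entropy ρ = spectralEntropy ρ / log 2 := by
  obtain ⟨U, -, hU, h1, h2⟩ := h.exists_unitary_diagonal
  have : ρ * cfc (logb 2) ρ = U * (diagonal (fun i => (h.eigenvalues i : ℂ)) *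
      diagonal (fun i => (logb 2 (h.eigenvalues i) : ℂ))) * Uᴴ := by
    rw [h2]
    nth_rw 1 [h1]
    simp only [Matrix.mul_assoc]
    rw [← Matrix.mul_assoc Uᴴ U, hU, Matrix.one_mul]
  rw [entropy, this, trace_mul_comm, ← Matrix.mul_assoc, hU, Matrix.one_mul, diagonal_mul_diagonal,
    trace_diagonal, spectralEntropy_eq_sum_eigenvalues h, Complex.re_sum, ← Finset.sum_neg_distrib,
    Finset.sum_div]
  refine Finset.sum_congr rfl fun i _ => ?_
  rw [← Complex.ofReal_mul, Complex.ofReal_re, negMulLog, logb]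
  ring

/-- The two characteristic polynomials differ by a power of `X`, and the root zero contributes
`negMulLog 0 = 0`. -/
theorem spectralEntropy_mul_comm (V : Matrix α β ℂ) (W : Matrix β α ℂ) :
    spectralEntropy (V * W) = spectralEntropy (W * V) := by
  have h := congrArg Polynomial.roots (charpoly_mul_comm' V W)
  rw [Polynomial.roots_mul, Polynomial.roots_mul, Polynomial.roots_X_pow,
    Polynomial.roots_X_pow] at h
  · have h2 := congrArg (fun s : Multiset ℂ => (s.map fun z => negMulLog z.re).sum) h
    simpa [spectralEntropy, Multiset.map_nsmul, Multiset.sum_nsmul] using h2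
  · exact mul_ne_zero (pow_ne_zero _ Polynomial.X_ne_zero) (charpoly_monic _).ne_zero
  · exact mul_ne_zero (pow_ne_zero _ Polynomial.X_ne_zero) (charpoly_monic _).ne_zero

theorem spectralEntropy_submatrix_equiv (ρ : Matrix α α ℂ) (e : β ≃ α) :
    spectralEntropy (ρ.submatrix e e) = spectralEntropy ρ := by
  rw [spectralEntropy, spectralEntropy, ← charpoly_reindex e.symm ρ]
  rfl

/-! ### Diagonals, mixtures and concavity -/

/-- The diagonal entries of a positive operator have at least its entropy. -/
theorem spectralEntropy_le_sum_diag {ρ : Matrix α α ℂ} (h : ρ.PosSemidef) :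
    spectralEntropy ρ ≤ ∑ x, negMulLog (ρ x x).re := by
  obtain ⟨U, hU, hU', h1, -⟩ := h.isHermitian.exists_unitary_diagonal
  set l := h.isHermitian.eigenvalues with hl
  have hl0 : ∀ i, 0 ≤ l i := h.eigenvalues_nonneg
  have hdiag : ∀ x, (ρ x x).re = ∑ i, Complex.normSq (U x i) * l i := by
    intro x
    rw [h1, mul_apply, Complex.re_sum]
    refine Finset.sum_congr rfl fun i _ => ?_
    rw [mul_diagonal, conjTranspose_apply, mul_right_comm, RCLike.star_def, Complex.mul_conj,
      ← Complex.ofReal_mul, Complex.ofReal_re]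
  have hrow : ∀ x, ∑ i, Complex.normSq (U x i) = 1 := by
    intro x
    have := congrFun (congrFun hU x) x
    simp only [mul_apply, conjTranspose_apply, RCLike.star_def, Complex.mul_conj, one_apply_eq]
      at this
    exact_mod_cast this
  have hcol : ∀ i, ∑ x, Complex.normSq (U x i) = 1 := by
    intro i
    have := congrFun (congrFun hU' i) i
    simp only [mul_apply, conjTranspose_apply, RCLike.star_def, mul_comm _ (U _ _),
      Complex.mul_conj, one_apply_eq] at this
    exact_mod_cast this
  -- The diagonal is the image of the spectrum under the doubly stochastic matrix `|U x i|²`. Column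
  -- sums spread the entropy over `x`, row sums allow Jensen.
  calc spectralEntropy ρ = ∑ i, ∑ x, Complex.normSq (U x i) * negMulLog (l i) := by
        rw [spectralEntropy_eq_sum_eigenvalues h.isHermitian]
        exact Finset.sum_congr rfl fun i _ => by rw [← Finset.sum_mul, hcol, one_mul]
    _ = ∑ x, ∑ i, Complex.normSq (U x i) * negMulLog (l i) := Finset.sum_comm
    _ ≤ _ := Finset.sum_le_sum fun x _ => by
        rw [hdiag]
        exact concaveOn_negMulLog.le_map_sum (fun i _ => Complex.normSq_nonneg _) (hrow x)
          fun i _ => hl0 i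

/-- The spectral decomposition of a positive operator into orthogonal, unnormalized vectors. -/
theorem _root_.Matrix.PosSemidef.exists_factorization {ρ : Matrix α α ℂ} (h : ρ.PosSemidef) :
    ∃ (W : Matrix α α ℂ) (l : α → ℝ), (∀ i, 0 ≤ l i) ∧ W * Wᴴ = ρ ∧
      Wᴴ * W = diagonal (fun i => (l i : ℂ)) ∧ spectralEntropy ρ = ∑ i, negMulLog (l i) := by
  obtain ⟨U, hU, hU', h1, -⟩ := h.isHermitian.exists_unitary_diagonal
  set l := h.isHermitian.eigenvalues with hl
  have hl0 : ∀ i, 0 ≤ l i := h.eigenvalues_nonneg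
  have hD : ∀ i, ((√(l i) : ℝ) : ℂ) * (√(l i) : ℝ) = l i := fun i => by
    rw [← Complex.ofReal_mul, mul_self_sqrt (hl0 i)]
  refine ⟨U * diagonal fun i => ((√(l i) : ℝ) : ℂ), l, hl0, ?_, ?_,
    spectralEntropy_eq_sum_eigenvalues h.isHermitian⟩
  · rw [h1, conjTranspose_mul, diagonal_conjTranspose, Matrix.mul_assoc, Matrix.mul_assoc,
      ← Matrix.mul_assoc (diagonal _) (diagonal _), diagonal_mul_diagonal]
    simp [hD]
  · rw [conjTranspose_mul, diagonal_conjTranspose, Matrix.mul_assoc, ← Matrix.mul_assoc Uᴴ, hU',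
      Matrix.one_mul, diagonal_mul_diagonal]
    simp [hD]

/-- An ensemble of unnormalized vectors, the columns of `W`, has a Shannon entropy of at least the
entropy of its average. -/
theorem spectralEntropy_mul_conjTranspose_le (W : Matrix α β ℂ) :
    spectralEntropy (W * Wᴴ) ≤ ∑ x, negMulLog ((Wᴴ * W) x x).re := by
  rw [spectralEntropy_mul_comm]
  exact spectralEntropy_le_sum_diag (posSemidef_conjTranspose_mul_self W)

/-- The scaled eigenvectors of both states form one ensemble for the mixture, with weights `s * l i`
and `t * m i`, whose Shannon entropy is the right-hand side. -/
theorem spectralEntropy_smul_add_smul_le {ρ τ : Matrix α α ℂ} (hρ : ρ.PosSemidef)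
    (hτ : τ.PosSemidef) (hρ1 : ρ.trace = 1) (hτ1 : τ.trace = 1) {s t : ℝ} (hs : 0 ≤ s)
    (ht : 0 ≤ t) :
    spectralEntropy ((s : ℂ) • ρ + (t : ℂ) • τ) ≤
      s * spectralEntropy ρ + t * spectralEntropy τ + (negMulLog s + negMulLog t) := by
  obtain ⟨V, l, -, h1, h2, h3⟩ := hρ.exists_factorization
  obtain ⟨W, m, -, h4, h5, h6⟩ := hτ.exists_factorization
  have hl : ∑ i, l i = 1 := by
    have : (diagonal fun i => (l i : ℂ)).trace = 1 := by rw [← h2, trace_mul_comm, h1, hρ1]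
    rw [trace_diagonal] at this
    exact_mod_cast this
  have hm : ∑ i, m i = 1 := by
    have : (diagonal fun i => (m i : ℂ)).trace = 1 := by rw [← h5, trace_mul_comm, h4, hτ1]
    rw [trace_diagonal] at this
    exact_mod_cast this
  have hsq : ∀ {r : ℝ}, 0 ≤ r → ((√r : ℝ) : ℂ) * (√r : ℝ) = r := fun hr => by
    rw [← Complex.ofReal_mul, mul_self_sqrt hr]
  have key := spectralEntropy_mul_conjTranspose_le
    (fromCols (((√s : ℝ) : ℂ) • V) (((√t : ℝ) : ℂ) • W))
  rw [conjTranspose_fromCols_eq_fromRows_conjTranspose, fromCols_mul_fromRows,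
    fromRows_mul_fromCols, Fintype.sum_sum_type] at key
  simp only [fromBlocks_apply₁₁, fromBlocks_apply₂₂, conjTranspose_smul, RCLike.star_def,
    Complex.conj_ofReal, smul_mul_smul, hsq hs, hsq ht, h1, h2, h4, h5, Matrix.smul_apply,
    diagonal_apply_eq, smul_eq_mul, ← Complex.ofReal_mul, Complex.ofReal_re, negMulLog_mul,
    Finset.sum_add_distrib, ← Finset.sum_mul, ← Finset.mul_sum, hl, hm] at key
  rw [h3, h6]
  linarith

theorem spectralEntropy_conj_unitary {U : Matrix α α ℂ} (hU : Uᴴ * U = 1) (ρ : Matrix α α ℂ) :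
    spectralEntropy (Uᴴ * ρ * U) = spectralEntropy ρ := by
  rw [spectralEntropy_mul_comm, ← Matrix.mul_assoc, mul_eq_one_comm.mp hU, Matrix.one_mul]

/-- The von Neumann entropy is concave. -/
theorem smul_add_smul_le_spectralEntropy {ρ τ : Matrix α α ℂ} (hρ : ρ.PosSemidef)
    (hτ : τ.PosSemidef) {s t : ℝ} (hs : 0 ≤ s) (ht : 0 ≤ t) (hst : s + t = 1) :
    s * spectralEntropy ρ + t * spectralEntropy τ ≤
      spectralEntropy ((s : ℂ) • ρ + (t : ℂ) • τ) := by
  have hγ : ((s : ℂ) • ρ + (t : ℂ) • τ).IsHermitian :=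
    ((hρ.smul (by exact_mod_cast hs)).add (hτ.smul (by exact_mod_cast ht))).isHermitian
  obtain ⟨U, -, hU, h1, -⟩ := hγ.exists_unitary_diagonal
  set l := hγ.eigenvalues
  have h2 : (s : ℂ) • (Uᴴ * ρ * U) + (t : ℂ) • (Uᴴ * τ * U) = diagonal fun i => (l i : ℂ) := by
    have : Uᴴ * ((s : ℂ) • ρ + (t : ℂ) • τ) * U = diagonal fun i => (l i : ℂ) := by
      rw [h1, Matrix.mul_assoc, Matrix.mul_assoc, hU, Matrix.mul_one, ← Matrix.mul_assoc, hU,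
        Matrix.one_mul]
    rw [← this]
    simp [Matrix.mul_add, Matrix.add_mul]
  have hρ' := hρ.conjTranspose_mul_mul_same U
  have hτ' := hτ.conjTranspose_mul_mul_same U
  rw [spectralEntropy_eq_sum_eigenvalues hγ, ← spectralEntropy_conj_unitary hU ρ,
    ← spectralEntropy_conj_unitary hU τ]
  -- In an eigenbasis of the mixture its spectrum is the mixture of the two diagonals, so scalar
  -- concavity suffices.
  calc _ ≤ s * ∑ x, negMulLog ((Uᴴ * ρ * U) x x).re + t * ∑ x, negMulLog ((Uᴴ * τ * U) x x).re := by
        gcongr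
        · exact spectralEntropy_le_sum_diag hρ'
        · exact spectralEntropy_le_sum_diag hτ'
    _ ≤ _ := by
        rw [Finset.mul_sum, Finset.mul_sum, ← Finset.sum_add_distrib]
        refine Finset.sum_le_sum fun x _ => ?_
        have h3 := congrArg Complex.re (congrFun (congrFun h2 x) x)
        simp only [Matrix.add_apply, Matrix.smul_apply, smul_eq_mul, diagonal_apply_eq, Complex.add_re,
          Complex.re_ofReal_mul, Complex.ofReal_re] at h3
        have h4 := concaveOn_negMulLog.2 (x := ((Uᴴ * ρ * U) x x).re) (y := ((Uᴴ * τ * U) x x).re)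
          (Complex.nonneg_iff.mp hρ'.diag_nonneg).1 (Complex.nonneg_iff.mp hτ'.diag_nonneg).1
          hs ht hst
        simp only [smul_eq_mul, h3] at h4
        exact h4

/-! ### Partial trace, subadditivity and Araki–Lieb -/

/-- The partial trace over the second tensor factor. -/
def partialTrace : Matrix (α × β) (α × β) ℂ →ₗ[ℂ] Matrix α α ℂ where
  toFun X := Matrix.of fun r s => ∑ b, X (r, b) (s, b)
  map_add' X Y := by ext r s; simp [Finset.sum_add_distrib]
  map_smul' c X := by ext r s; simp [Finset.mul_sum]

theorem partialTrace_apply (X : Matrix (α × β) (α × β) ℂ) (r s : α) :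
    partialTrace X r s = ∑ b, X (r, b) (s, b) := rfl

theorem trace_partialTrace (X : Matrix (α × β) (α × β) ℂ) : (partialTrace X).trace = X.trace := by
  simp [trace, partialTrace_apply, Fintype.sum_prod_type]

open scoped Kronecker in
theorem partialTrace_conj_kronecker (U : Matrix α α ℂ) (X : Matrix (α × β) (α × β) ℂ) :
    partialTrace ((U ⊗ₖ (1 : Matrix β β ℂ))ᴴ * X * (U ⊗ₖ (1 : Matrix β β ℂ))) =
      Uᴴ * partialTrace X * U := by
  ext r s
  simp only [partialTrace_apply, mul_apply, conjTranspose_apply, kroneckerMap_apply,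
    Fintype.sum_prod_type, one_apply, Finset.sum_mul, Finset.mul_sum, mul_ite, mul_one, mul_zero,
    ite_mul, zero_mul, star_zero, Finset.sum_ite_eq', Finset.mem_univ, if_true,
    apply_ite star]
  rw [Finset.sum_comm]
  refine Finset.sum_congr rfl fun i _ => ?_
  rw [Finset.sum_comm]

/-- Jensen with uniform weights: splitting a mass into `d` pieces gains at most `log d` per unit of
mass. -/
theorem sum_negMulLog_le [Nonempty β] {p : β → ℝ} (hp : ∀ b, 0 ≤ p b) :
    ∑ b, negMulLog (p b) ≤ negMulLog (∑ b, p b) + (∑ b, p b) * log (Fintype.card β) := by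
  have hd : (0 : ℝ) < Fintype.card β := by exact_mod_cast Fintype.card_pos
  have h := concaveOn_negMulLog.le_map_sum (t := Finset.univ) (w := fun _ : β =>
    (Fintype.card β : ℝ)⁻¹) (p := p) (fun _ _ => by positivity) (by simp [hd.ne'])
    (fun b _ => hp b)
  simp only [smul_eq_mul, ← Finset.mul_sum, negMulLog_mul] at h
  rw [negMulLog, log_inv] at h
  have h2 := mul_le_mul_of_nonneg_left h hd.le
  field_simp at h2
  linarith

theorem sum_eigenvalues_eq_one {ρ : Matrix α α ℂ} (h : ρ.IsHermitian) (h1 : ρ.trace = 1) :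
    ∑ i, h.eigenvalues i = 1 := by
  have := congrArg Complex.re h.trace_eq_sum_eigenvalues
  simpa [h1] using this.symm

/-- Subadditivity of the entropy, with a factor of maximal entropy. -/
theorem spectralEntropy_le_partialTrace_add [Nonempty β] {ρ : Matrix (α × β) (α × β) ℂ}
    (h : IsState ρ) :
    spectralEntropy ρ ≤ spectralEntropy (partialTrace ρ) + log (Fintype.card β) := by
  open scoped Kronecker in
  have hR : (partialTrace ρ).IsHermitian := by
    ext r s
    simp only [conjTranspose_apply, partialTrace_apply, star_sum]
    exact Finset.sum_congr rfl fun b _ => h.posSemidef.isHermitian.apply _ _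
  obtain ⟨U, hU', hU, h1, -⟩ := hR.exists_unitary_diagonal
  set V := U ⊗ₖ (1 : Matrix β β ℂ) with hV
  have hVV : Vᴴ * V = 1 := by
    rw [hV, conjTranspose_kronecker, ← mul_kronecker_mul, hU, conjTranspose_one, Matrix.one_mul,
      one_kronecker_one]
  have hps := h.posSemidef.conjTranspose_mul_mul_same V
  have hdiag := partialTrace_conj_kronecker U ρ
  have h2 : Uᴴ * partialTrace ρ * U = diagonal fun i => (hR.eigenvalues i : ℂ) := by
    nth_rw 1 [h1]
    rw [Matrix.mul_assoc, Matrix.mul_assoc, hU, Matrix.mul_one, ← Matrix.mul_assoc, hU,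
      Matrix.one_mul]
  rw [h2, ← hV] at hdiag
  -- In an eigenbasis of the marginal, the diagonal of the joint state refines the marginal
  -- spectrum.
  have h3 : ∀ r, ∑ b, ((Vᴴ * ρ * V) (r, b) (r, b)).re = hR.eigenvalues r := fun r => by
    rw [← Complex.re_sum, ← partialTrace_apply, hdiag, diagonal_apply_eq, Complex.ofReal_re]
  have h4 : ∑ r, hR.eigenvalues r = 1 :=
    sum_eigenvalues_eq_one hR (by rw [trace_partialTrace, h.trace_eq_one])
  rw [← spectralEntropy_conj_unitary hVV, spectralEntropy_eq_sum_eigenvalues hR]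
  refine (spectralEntropy_le_sum_diag hps).trans ?_
  rw [Fintype.sum_prod_type]
  calc _ ≤ ∑ r, (negMulLog (hR.eigenvalues r) + hR.eigenvalues r * log (Fintype.card β)) :=
        Finset.sum_le_sum fun r _ => by
          rw [← h3]
          exact sum_negMulLog_le fun b => (Complex.nonneg_iff.mp hps.diag_nonneg).1
    _ = _ := by rw [Finset.sum_add_distrib, ← Finset.sum_mul, h4, one_mul]

/-- A form of the Araki–Lieb inequality. -/
theorem spectralEntropy_partialTrace_le_add [Nonempty β] {ρ : Matrix (α × β) (α × β) ℂ}
    (h : IsState ρ) :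
    spectralEntropy (partialTrace ρ) ≤ spectralEntropy ρ + log (Fintype.card β) := by
  obtain ⟨W, l, -, h1, h2, h3⟩ := h.posSemidef.exists_factorization
  have hl : ∑ i, l i = 1 := by
    have : (diagonal fun i => (l i : ℂ)).trace = 1 := by
      rw [← h2, trace_mul_comm, h1, h.trace_eq_one]
    rw [trace_diagonal] at this
    exact_mod_cast this
  -- Moving the `β` index from rows to columns turns an ensemble for `ρ` into one for its marginal,
  -- each weight `l k` being split into `card β` parts.
  let V : Matrix α ((α × β) × β) ℂ := Matrix.of fun r k => W (r, k.2) k.1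
  have hV : V * Vᴴ = partialTrace ρ := by
    ext r s
    rw [← h1]
    simp only [mul_apply, partialTrace_apply, V, conjTranspose_apply, of_apply]
    rw [Fintype.sum_prod_type, Finset.sum_comm]
  have hV2 : ∀ k, ∑ b, ((Vᴴ * V) (k, b) (k, b)).re = l k := by
    intro k
    have := congrArg Complex.re (congrFun (congrFun h2 k) k)
    rw [diagonal_apply_eq, Complex.ofReal_re] at this
    rw [← this, ← Complex.re_sum]
    simp only [mul_apply, V, conjTranspose_apply, of_apply]
    rw [Fintype.sum_prod_type, Finset.sum_comm]
  rw [← hV, h3]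
  refine (spectralEntropy_mul_conjTranspose_le V).trans ?_
  rw [Fintype.sum_prod_type]
  calc _ ≤ ∑ r, (negMulLog (l r) + l r * log (Fintype.card β)) :=
        Finset.sum_le_sum fun r _ => by
          rw [← hV2]
          exact sum_negMulLog_le fun b => (Complex.nonneg_iff.mp
            (posSemidef_conjTranspose_mul_self V).diag_nonneg).1
    _ = _ := by rw [Finset.sum_add_distrib, ← Finset.sum_mul, hl, one_mul]

/-! ### The Alicki–Fannes estimate -/

theorem spectralEntropy_sub_le_of_partialTrace_eq [Nonempty β] {ρ σ : Matrix (α × β) (α × β) ℂ}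
    (hρ : IsState ρ) (hσ : IsState σ) (h : partialTrace ρ = partialTrace σ) :
    spectralEntropy ρ - spectralEntropy σ ≤ 2 * log (Fintype.card β) := by
  have h1 := spectralEntropy_le_partialTrace_add hρ
  have h2 := spectralEntropy_partialTrace_le_add hσ
  rw [h] at h1
  linarith

/-- The entropy of the common mixture is bounded below by concavity on the `ρ` side and above by the
mixing bound on the `σ` side. -/
theorem spectralEntropy_sub_le_of_mixture_eq {ρ σ ρ' σ' : Matrix α α ℂ} (hρ : IsState ρ)
    (hσ : IsState σ) (hρ' : IsState ρ') (hσ' : IsState σ') {ε : ℝ} (h0 : 0 ≤ ε) (h1 : ε ≤ 1)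
    (h : ((1 - ε : ℝ) : ℂ) • ρ + (ε : ℂ) • ρ' = ((1 - ε : ℝ) : ℂ) • σ + (ε : ℂ) • σ') :
    (1 - ε) * (spectralEntropy ρ - spectralEntropy σ) ≤
      ε * (spectralEntropy σ' - spectralEntropy ρ') + binEntropy ε := by
  have h2 := smul_add_smul_le_spectralEntropy hρ.posSemidef hρ'.posSemidef (s := 1 - ε) (t := ε)
    (by linarith) h0 (by ring)
  have h3 := spectralEntropy_smul_add_smul_le hσ.posSemidef hσ'.posSemidef hσ.trace_eq_one
    hσ'.trace_eq_one (s := 1 - ε) (t := ε) (by linarith) h0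
  rw [h] at h2
  rw [binEntropy_eq_negMulLog_add_negMulLog_one_sub]
  linarith

/-- The Alicki–Fannes estimate for two states with the same marginal. -/
theorem spectralEntropy_sub_le [Nonempty β] {ρ σ P Q : Matrix (α × β) (α × β) ℂ}
    (hρ : IsState ρ) (hσ : IsState σ) (hm : partialTrace ρ = partialTrace σ)
    (hP : P.PosSemidef) (hQ : Q.PosSemidef) (hPQ : ρ - σ = P - Q) {ε t : ℝ} (h0 : 0 ≤ ε)
    (h1 : ε ≤ 1) (hPt : P.trace = t) (hQt : Q.trace = t) (ht : t ≤ ε / 2) :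
    spectralEntropy ρ - spectralEntropy σ ≤
      4 * ε * log (Fintype.card β) + 2 * binEntropy ε := by
  have hlog : 0 ≤ log (Fintype.card β : ℝ) := log_natCast_nonneg _
  have hH : 0 ≤ binEntropy ε := binEntropy_nonneg h0 h1
  have ht0 : 0 ≤ t := by
    have := hP.trace_nonneg
    rw [hPt] at this
    exact_mod_cast this
  rcases h0.eq_or_lt with rfl | hε
  -- The completing states below need `ε⁻¹`; for `ε = 0` the parts `P` and `Q` vanish.
  · obtain rfl : t = 0 := by linarith
    have h2 : ρ = σ := by
      rw [← sub_eq_zero, hPQ, hP.trace_eq_zero_iff.mp (by simpa using hPt),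
        hQ.trace_eq_zero_iff.mp (by simpa using hQt), sub_zero]
    simp [h2]
  rcases le_total ε (1 / 2) with hε2 | hε2
  -- The completing states are `((1 - ε) Q + c ρ) / ε` for `ρ` and `((1 - ε) P + c ρ) / ε` for `σ`,
  -- with `c` fixed by normalization. The mixtures agree since `ρ + Q = σ + P`; the same filler `c
  -- ρ` in both keeps their marginals equal.
  · have hc : 0 ≤ ε - (1 - ε) * t := by nlinarith
    set c := ε - (1 - ε) * t with hcdef
    have hstate : ∀ X : Matrix (α × β) (α × β) ℂ, X.PosSemidef → X.trace = t →
        IsState (((ε⁻¹ : ℝ) : ℂ) • (((1 - ε : ℝ) : ℂ) • X + (c : ℂ) • ρ)) := by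
      intro X hX hXt
      refine ⟨((hX.smul ?_).add (hρ.posSemidef.smul ?_)).smul ?_, ?_⟩
      · exact_mod_cast sub_nonneg.mpr h1
      · exact_mod_cast hc
      · exact_mod_cast inv_nonneg.mpr hε.le
      · rw [trace_smul, trace_add, trace_smul, trace_smul, hXt, hρ.trace_eq_one, hcdef]
        simp only [smul_eq_mul, mul_one]
        norm_cast
        rw [add_sub_cancel, inv_mul_cancel₀ hε.ne']
    have hscale : ∀ X : Matrix (α × β) (α × β) ℂ, (ε : ℂ) • ((ε⁻¹ : ℝ) : ℂ) • X = X := fun X => by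
      rw [smul_smul, ← Complex.ofReal_mul, mul_inv_cancel₀ hε.ne', Complex.ofReal_one, one_smul]
    have hpPQ : partialTrace P = partialTrace Q := by
      rw [← sub_eq_zero, ← map_sub, ← hPQ, map_sub, hm, sub_self]
    have h2 := spectralEntropy_sub_le_of_mixture_eq hρ hσ (hstate Q hQ hQt) (hstate P hP hPt) h0 h1
      (by
        rw [hscale, hscale, ← sub_eq_zero]
        have : ((1 - ε : ℝ) : ℂ) • (ρ - σ) = ((1 - ε : ℝ) : ℂ) • (P - Q) := by rw [hPQ]
        rw [smul_sub, smul_sub] at this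
        rw [← sub_eq_zero] at this
        rw [← this]
        abel)
    have h3 := spectralEntropy_sub_le_of_partialTrace_eq (hstate P hP hPt) (hstate Q hQ hQt)
      (by simp only [map_smul, map_add, hpPQ])
    have h4 := mul_le_mul_of_nonneg_left h3 hε.le
    rcases le_total (spectralEntropy ρ - spectralEntropy σ) 0 with h5 | h5
    · exact h5.trans (by positivity)
    -- Here `1 - ε ≥ 1 / 2`, so dividing by it at most doubles `2 ε log d + H(ε)`.
    · nlinarith
  -- For `ε ≥ 1 / 2` the crude bound `2 log d` is already at most `4 ε log d`.
  · have := spectralEntropy_sub_le_of_partialTrace_eq hρ hσ hm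
    nlinarith

/-! ### Trace norm and Jordan decomposition -/

theorem traceNorm_eq_sum_abs_eigenvalues {D : Matrix α α ℂ} (h : D.IsHermitian) :
    traceNorm D = ∑ i, |h.eigenvalues i| := by
  obtain ⟨U, -, hU, -, h1⟩ := h.exists_unitary_diagonal
  have hsa : IsSelfAdjoint D := h
  have h2 : cfc sqrt (Dᴴ * D) = cfc (fun x : ℝ => |x|) D := by
    rw [h.eq, ← pow_two, ← cfc_comp_pow sqrt 2 D]
    simp only [sqrt_sq_eq_abs]
  rw [traceNorm, h2, h1, trace_mul_comm, ← Matrix.mul_assoc, hU, Matrix.one_mul, trace_diagonal,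
    Complex.re_sum]
  simp

theorem IsState.traceNorm_eq_one {ρ : Matrix α α ℂ} (h : IsState ρ) : traceNorm ρ = 1 := by
  rw [traceNorm_eq_sum_abs_eigenvalues h.posSemidef.isHermitian]
  simp only [abs_of_nonneg (h.posSemidef.eigenvalues_nonneg _)]
  exact sum_eigenvalues_eq_one _ h.trace_eq_one

/-- The Jordan decomposition of a Hermitian operator. -/
theorem _root_.Matrix.IsHermitian.exists_posSemidef_sub {D : Matrix α α ℂ} (h : D.IsHermitian) :
    ∃ (P Q : Matrix α α ℂ) (s t : ℝ), P.PosSemidef ∧ Q.PosSemidef ∧ D = P - Q ∧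
      P.trace = s ∧ Q.trace = t ∧ traceNorm D = s + t := by
  obtain ⟨U, -, hU, h1, -⟩ := h.exists_unitary_diagonal
  have htr : ∀ f : α → ℝ, (U * diagonal (fun i => (f i : ℂ)) * Uᴴ).trace = (∑ i, f i : ℝ) := by
    intro f
    rw [trace_mul_comm, ← Matrix.mul_assoc, hU, Matrix.one_mul, trace_diagonal, Complex.ofReal_sum]
  have hps : ∀ f : α → ℝ, (∀ i, 0 ≤ f i) →
      (U * diagonal (fun i => (f i : ℂ)) * Uᴴ).PosSemidef := fun f hf =>
    (PosSemidef.diagonal fun i => Complex.zero_le_real.mpr (hf i)).mul_mul_conjTranspose_same U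
  refine ⟨_, _, _, _, hps (fun i => (h.eigenvalues i)⁺) fun i => posPart_nonneg _,
    hps (fun i => (h.eigenvalues i)⁻) fun i => negPart_nonneg _, ?_, htr _, htr _, ?_⟩
  · rw [← Matrix.sub_mul, ← Matrix.mul_sub, diagonal_sub]
    simp only [← Complex.ofReal_sub, posPart_sub_negPart]
    exact h1
  · rw [traceNorm_eq_sum_abs_eigenvalues h, ← Finset.sum_add_distrib]
    simp only [posPart_add_negPart]

/-- The entropies of two states with the same marginal differ little if the states do. -/
theorem abs_spectralEntropy_sub_le [Nonempty β] {ρ σ : Matrix (α × β) (α × β) ℂ}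
    (hρ : IsState ρ) (hσ : IsState σ) (hm : partialTrace ρ = partialTrace σ) {ε : ℝ} (h0 : 0 ≤ ε)
    (h1 : ε ≤ 1) (hε : traceNorm (ρ - σ) ≤ ε) :
    |spectralEntropy ρ - spectralEntropy σ| ≤
      4 * ε * log (Fintype.card β) + 2 * binEntropy ε := by
  obtain ⟨P, Q, s, t, hP, hQ, hPQ, hs, ht, hst⟩ :=
    (hρ.posSemidef.isHermitian.sub hσ.posSemidef.isHermitian).exists_posSemidef_sub
  -- The difference of two states is traceless, so each part has half the trace norm; this is the `ε
  -- / 2` above.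
  obtain rfl : s = t := by
    have := congrArg trace hPQ
    rw [trace_sub, trace_sub, hρ.trace_eq_one, hσ.trace_eq_one, sub_self, hs, ht] at this
    exact_mod_cast (sub_eq_zero.mp this.symm)
  rw [abs_sub_le_iff]
  exact ⟨spectralEntropy_sub_le hρ hσ hm hP hQ hPQ h0 h1 hs ht (by linarith),
    spectralEntropy_sub_le hσ hρ hm.symm hQ hP (by rw [← neg_sub, hPQ, neg_sub]) h0 h1 ht hs
      (by linarith)⟩

/-! ### Channels acting beside a reference system -/

theorem IsState.submatrix_equiv {ρ : Matrix α α ℂ} (h : IsState ρ) (e : β ≃ α) :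
    IsState (ρ.submatrix e e) :=
  ⟨h.posSemidef.submatrix e, by
    rw [← h.trace_eq_one]
    exact e.sum_comp fun i => ρ i i⟩

theorem linearMap_apply_eq_sum (Φ : Matrix α α ℂ →ₗ[ℂ] Matrix β β ℂ) (X : Matrix α α ℂ)
    (x y : β) : Φ X x y = ∑ i, ∑ j, X i j * Φ (single i j 1) x y := by
  conv_lhs => rw [matrix_eq_sum_single X]
  simp only [map_sum, Matrix.sum_apply]
  refine Finset.sum_congr rfl fun i _ => Finset.sum_congr rfl fun j _ => ?_
  rw [← mul_one (X i j), ← smul_eq_mul, ← smul_single, map_smul, Matrix.smul_apply, smul_eq_mul,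
    smul_eq_mul, mul_one]

theorem idTensor_submatrix {R R' : Type*} (e : R' → R) (Φ : Matrix α α ℂ →ₗ[ℂ] Matrix β β ℂ)
    (X : Matrix (R × α) (R × α) ℂ) :
    idTensor R' Φ (X.submatrix (Prod.map e id) (Prod.map e id)) =
      (idTensor R Φ X).submatrix (Prod.map e id) (Prod.map e id) := rfl

theorem idTensor_sub (R : Type*) (Φ Ψ : Matrix α α ℂ →ₗ[ℂ] Matrix β β ℂ)
    (X : Matrix (R × α) (R × α) ℂ) : idTensor R (Φ - Ψ) X = idTensor R Φ X - idTensor R Ψ X := rfl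

/-- The partial trace takes the trace of every block, and `Φ` preserves each of these. -/
theorem partialTrace_idTensor {R : Type*} [Fintype R] [DecidableEq R]
    {Φ : Matrix α α ℂ →ₗ[ℂ] Matrix β β ℂ}
    (h : ∀ X, (Φ X).trace = X.trace) (X : Matrix (R × α) (R × α) ℂ) :
    partialTrace (idTensor R Φ X) = partialTrace X := by
  ext r s
  exact h (of fun i j => X (r, i) (s, j))

theorem IsCompletelyPositive.posSemidef {R : Type*} [Fintype R]
    {Φ : Matrix α α ℂ →ₗ[ℂ] Matrix β β ℂ} (h : IsCompletelyPositive Φ)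
    {X : Matrix (R × α) (R × α) ℂ} (hX : X.PosSemidef) : (idTensor R Φ X).PosSemidef := by
  let e := Fintype.equivFin R
  have := (h _ _ (hX.submatrix (Prod.map e.symm id))).submatrix (Prod.map e id)
  rw [idTensor_submatrix, submatrix_submatrix, Prod.map_comp_map] at this
  simpa using this

theorem IsChannel.isState {R : Type*} [Fintype R] [DecidableEq R]
    {Φ : Matrix α α ℂ →ₗ[ℂ] Matrix β β ℂ} (h : IsChannel Φ)
    {X : Matrix (R × α) (R × α) ℂ} (hX : IsState X) : IsState (idTensor R Φ X) :=
  ⟨h.completelyPositive.posSemidef hX.posSemidef, by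
    rw [← trace_partialTrace, partialTrace_idTensor h.trace_map, trace_partialTrace,
      hX.trace_eq_one]⟩

/-- It is enough to bound the difference of output entropies for reference systems `Fin k`. -/
theorem abs_spectralEntropy_idTensor_sub_le_of_fin {Φ Ψ : Matrix α α ℂ →ₗ[ℂ] Matrix β β ℂ} {C : ℝ}
    (h : ∀ (k : ℕ) (X : Matrix (Fin k × α) (Fin k × α) ℂ), IsState X →
      |spectralEntropy (idTensor (Fin k) Φ X) - spectralEntropy (idTensor (Fin k) Ψ X)| ≤ C)
    {R : Type*} [Fintype R] [DecidableEq R] {X : Matrix (R × α) (R × α) ℂ} (hX : IsState X) :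
    |spectralEntropy (idTensor R Φ X) - spectralEntropy (idTensor R Ψ X)| ≤ C := by
  let e := (Fintype.equivFin R).symm
  have h1 := h _ _ (hX.submatrix_equiv (e.prodCongr (Equiv.refl α)))
  have h2 : ∀ Θ : Matrix α α ℂ →ₗ[ℂ] Matrix β β ℂ,
      spectralEntropy (idTensor _ Θ (X.submatrix (e.prodCongr (Equiv.refl α))
        (e.prodCongr (Equiv.refl α)))) = spectralEntropy (idTensor R Θ X) := fun Θ =>
    spectralEntropy_submatrix_equiv (idTensor R Θ X) (e.prodCongr (Equiv.refl β))
  rwa [h2, h2] at h1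

/-- Continuity of the output entropy in a channel. -/
theorem abs_spectralEntropy_idTensor_sub_le {N M : Matrix α α ℂ →ₗ[ℂ] Matrix β β ℂ}
    (hN : IsChannel N) (hM : IsChannel M) {ε : ℝ} (h0 : 0 ≤ ε) (h1 : ε ≤ 1)
    (hNM : diamondNorm (N - M) ≤ ENNReal.ofReal ε) {R : Type*} [Fintype R] [DecidableEq R]
    {X : Matrix (R × α) (R × α) ℂ} (hX : IsState X) :
    |spectralEntropy (idTensor R N X) - spectralEntropy (idTensor R M X)| ≤
      4 * ε * log (Fintype.card β) + 2 * binEntropy ε := by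
  refine abs_spectralEntropy_idTensor_sub_le_of_fin (fun k X hX => ?_) hX
  -- An empty output system carries no operator of trace one.
  have hβ : Nonempty β := by
    by_contra hβ
    rw [not_nonempty_iff] at hβ
    simpa [trace] using (hN.isState hX).trace_eq_one
  refine abs_spectralEntropy_sub_le (hN.isState hX) (hM.isState hX) ?_ h0 h1 ?_
  · rw [partialTrace_idTensor hN.trace_map, partialTrace_idTensor hM.trace_map]
  · rw [← idTensor_sub, ← ENNReal.ofReal_le_ofReal_iff h0]
    exact (le_iSup₂_of_le (f := fun k X => ⨆ _ : traceNorm X = 1, ENNReal.ofReal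
      (traceNorm (idTensor (Fin k) (N - M) X))) k X (le_iSup (fun _ => ENNReal.ofReal
      (traceNorm (idTensor (Fin k) (N - M) X))) hX.traceNorm_eq_one)).trans hNM

/-! ### Tensor powers and the exchange argument -/

/-- Exchanging the last two of three tensor factors. -/
def prodRightComm (α β γ : Type*) : (α × β) × γ ≃ (α × γ) × β where
  toFun p := ((p.1.1, p.2), p.1.2)
  invFun p := ((p.1.1, p.2), p.1.2)

/-- Maps on different factors commute, as expansion in matrix units shows. This lets the exchange
argument choose which factor acts last. -/
theorem idTensor_comm {A γ δ : Type*} [Fintype γ] [DecidableEq γ] [Fintype δ] [DecidableEq δ]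
    (Φ : Matrix α α ℂ →ₗ[ℂ] Matrix β β ℂ) (Ψ : Matrix γ γ ℂ →ₗ[ℂ] Matrix δ δ ℂ)
    (X : Matrix ((A × α) × γ) ((A × α) × γ) ℂ) :
    idTensor (A × δ) Φ ((idTensor (A × α) Ψ X).submatrix
        (prodRightComm A δ α) (prodRightComm A δ α)) =
      (idTensor (A × β) Ψ ((idTensor (A × γ) Φ (X.submatrix
        (prodRightComm A γ α) (prodRightComm A γ α))).submatrix
        (prodRightComm A β γ) (prodRightComm A β γ))).submatrix
        (prodRightComm A δ β) (prodRightComm A δ β) := by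
  ext ⟨⟨a, d⟩, b⟩ ⟨⟨a', d'⟩, b'⟩
  change Φ (of fun s t => Ψ (of fun u v => X ((a, s), u) ((a', t), v)) d d') b b' =
    Ψ (of fun u v => Φ (of fun s t => X ((a, s), u) ((a', t), v)) b b') d d'
  simp only [linearMap_apply_eq_sum Φ (of _), linearMap_apply_eq_sum Ψ (of _), of_apply,
    Finset.sum_mul]
  simp only [← Fintype.sum_prod_type' (f := fun (u v : γ) => _),
    ← Fintype.sum_prod_type' (f := fun (u v : α) => _)]
  rw [Finset.sum_comm]
  simp only [mul_right_comm]

/-- Splitting off the first of `n + 1` copies of a system. -/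
def splitEquiv (A α : Type*) (n : ℕ) : (A × α) × (Fin n → α) ≃ A × (Fin (n + 1) → α) :=
  (Equiv.prodAssoc A α (Fin n → α)).trans
    ((Equiv.refl A).prodCongr (Fin.consEquiv fun _ => α))

theorem idTensor_tensorPow_succ {A : Type*} (n : ℕ) (Φ : Matrix α α ℂ →ₗ[ℂ] Matrix β β ℂ)
    (X : Matrix (A × (Fin (n + 1) → α)) (A × (Fin (n + 1) → α)) ℂ) :
    (idTensor A (tensorPow (n + 1) Φ) X).submatrix (splitEquiv A β n) (splitEquiv A β n) =
      (idTensor (A × (Fin n → β)) Φ ((idTensor (A × α) (tensorPow n Φ)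
        (X.submatrix (splitEquiv A α n) (splitEquiv A α n))).submatrix
        (prodRightComm A (Fin n → β) α) (prodRightComm A (Fin n → β) α))).submatrix
        (prodRightComm A β (Fin n → β)) (prodRightComm A β (Fin n → β)) := by
  ext ⟨⟨a, b⟩, f⟩ ⟨⟨a', b'⟩, f'⟩
  change ∑ i : Fin (n + 1) → α, ∑ j : Fin (n + 1) → α, X (a, i) (a', j) *
      ∏ k, Φ (single (i k) (j k) 1) ((Fin.cons b f : Fin (n + 1) → β) k)
        ((Fin.cons b' f' : Fin (n + 1) → β) k) =
    Φ (of fun s t => ∑ i : Fin n → α, ∑ j : Fin n → α, X (a, Fin.cons s i) (a', Fin.cons t j) *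
      ∏ k, Φ (single (i k) (j k) 1) (f k) (f' k)) b b'
  rw [linearMap_apply_eq_sum]
  simp only [← (Fin.consEquiv fun _ : Fin (n + 1) => α).sum_comp, Fin.consEquiv, Equiv.coe_fn_mk,
    Fintype.sum_prod_type, Fin.prod_univ_succ, Fin.cons_zero, Fin.cons_succ, of_apply,
    Finset.sum_mul]
  refine Finset.sum_congr rfl fun s _ => ?_
  rw [Finset.sum_comm]
  refine Finset.sum_congr rfl fun t _ => Finset.sum_congr rfl fun i _ =>
    Finset.sum_congr rfl fun j _ => ?_
  ring

theorem idTensor_tensorPow_zero {A : Type*} (Φ : Matrix α α ℂ →ₗ[ℂ] Matrix β β ℂ)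
    (X : Matrix (A × (Fin 0 → α)) (A × (Fin 0 → α)) ℂ) :
    idTensor A (tensorPow 0 Φ) X =
      X.submatrix (Prod.map id fun _ => Fin.elim0) (Prod.map id fun _ => Fin.elim0) := by
  ext ⟨a, f⟩ ⟨a', f'⟩
  simp [idTensor, tensorPow, Subsingleton.elim (default : Fin 0 → α) Fin.elim0]

theorem trace_tensorPow {Φ : Matrix α α ℂ →ₗ[ℂ] Matrix β β ℂ}
    (h : ∀ X, (Φ X).trace = X.trace) (n : ℕ) (X : Matrix (Fin n → α) (Fin n → α) ℂ) :
    (tensorPow n Φ X).trace = X.trace := by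
  have h1 : ∀ i j : Fin n → α, ∑ x : Fin n → β, ∏ k, Φ (single (i k) (j k) 1) (x k) (x k) =
      if i = j then 1 else 0 := by
    intro i j
    rw [← Fintype.piFinset_univ, ← Finset.prod_univ_sum (fun _ => Finset.univ)
      fun k x => Φ (single (i k) (j k) 1) x x]
    have h2 : ∀ k, ∑ x, Φ (single (i k) (j k) 1) x x = if i k = j k then 1 else 0 := by
      intro k
      refine (h (single (i k) (j k) 1)).trans ?_
      split_ifs with hk
      · rw [hk, trace_single_eq_same]
      · rw [trace_single_eq_of_ne _ _ _ hk]
    simp only [h2, Finset.prod_ite_zero, Finset.mem_univ, true_imp_iff, funext_iff,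
      Finset.prod_const_one]
  simp only [trace, diag_apply, tensorPow, LinearMap.coe_mk, AddHom.coe_mk, of_apply]
  rw [Finset.sum_comm]
  refine Finset.sum_congr rfl fun i _ => ?_
  rw [Finset.sum_comm]
  simp only [← Finset.mul_sum, h1]
  simp

/-- Complete positivity follows by induction, the other copies serving as part of the reference. -/
theorem IsChannel.tensorPow {Φ : Matrix α α ℂ →ₗ[ℂ] Matrix β β ℂ} (h : IsChannel Φ) (n : ℕ) :
    IsChannel (tensorPow n Φ) := by
  refine ⟨?_, trace_tensorPow h.trace_map n⟩
  induction n with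
  | zero =>
    intro k X hX
    rw [idTensor_tensorPow_zero]
    exact hX.submatrix _
  | succ n ih =>
    intro k X hX
    rw [← posSemidef_submatrix_equiv (splitEquiv (Fin k) β n), idTensor_tensorPow_succ]
    exact (h.completelyPositive.posSemidef
      ((ih.posSemidef (hX.submatrix _)).submatrix _)).submatrix _

/-- Continuity of the output entropy in tensor powers of a channel, by exchanging the factors one
at a time. -/
theorem abs_spectralEntropy_idTensor_tensorPow_sub_le {N M : Matrix α α ℂ →ₗ[ℂ] Matrix β β ℂ}
    (hN : IsChannel N) (hM : IsChannel M) {C : ℝ}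
    (hC : ∀ (k : ℕ) (X : Matrix (Fin k × α) (Fin k × α) ℂ), IsState X →
      |spectralEntropy (idTensor (Fin k) N X) - spectralEntropy (idTensor (Fin k) M X)| ≤ C)
    (n : ℕ) {R : Type*} [Fintype R] [DecidableEq R]
    {X : Matrix (R × (Fin n → α)) (R × (Fin n → α)) ℂ} (hX : IsState X) :
    |spectralEntropy (idTensor R (tensorPow n N) X) -
      spectralEntropy (idTensor R (tensorPow n M) X)| ≤ n * C := by
  refine abs_spectralEntropy_idTensor_sub_le_of_fin ?_ hX
  clear hX X
  intro k X hX
  -- The reference must vary, as it absorbs the output of the first copy.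
  induction n generalizing k with
  | zero => simp [idTensor_tensorPow_zero]
  | succ n ih =>
    have hY := hX.submatrix_equiv (splitEquiv (Fin k) α n)
    -- The intermediate output has `M` on the first copy and `N` on the others: `h1` exchanges the
    -- first copy, `h2` the remaining `n`.
    have h1 := abs_spectralEntropy_idTensor_sub_le_of_fin hC
      (((hN.tensorPow n).isState hY).submatrix_equiv (prodRightComm (Fin k) (Fin n → β) α))
    have h2 := abs_spectralEntropy_idTensor_sub_le_of_fin (fun k X hX => ih k X hX)
      ((hM.isState (hY.submatrix_equiv (prodRightComm (Fin k) (Fin n → α) α))).submatrix_equiv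
        (prodRightComm (Fin k) β (Fin n → α)))
    have h3 : ∀ Φ : Matrix α α ℂ →ₗ[ℂ] Matrix β β ℂ,
        spectralEntropy (idTensor (Fin k) (tensorPow (n + 1) Φ) X) = _ := fun Φ => by
      rw [← spectralEntropy_submatrix_equiv _ (splitEquiv (Fin k) β n), idTensor_tensorPow_succ,
        spectralEntropy_submatrix_equiv]
    rw [h3 N, h3 M]
    rw [← spectralEntropy_submatrix_equiv _ (prodRightComm (Fin k) (Fin n → β) β),
      ← idTensor_comm, ← spectralEntropy_submatrix_equiv (idTensor _ (tensorPow n M) _)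
        (prodRightComm (Fin k) (Fin n → β) β), ← idTensor_comm] at h2
    push_cast
    calc _ ≤ _ := abs_sub_le _ _ _
      _ ≤ _ := add_le_add h1 h2
      _ = _ := by ring

theorem binaryEntropy_eq_binEntropy_div (p : ℝ) : binaryEntropy p = binEntropy p / log 2 := by
  rw [binaryEntropy, binEntropy_eq_negMulLog_add_negMulLog_one_sub, negMulLog, negMulLog, logb,
    logb]
  ring

end Quantum

theorem mainTheorem1
    {A A' B : Type*} [Fintype A] [DecidableEq A] [Fintype A'] [DecidableEq A']
    [Fintype B] [DecidableEq B]
    (N M : Matrix A' A' ℂ →ₗ[ℂ] Matrix B B ℂ)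
    (hN : Quantum.IsChannel N) (hM : Quantum.IsChannel M)
    (ε : ℝ) (hε0 : 0 ≤ ε) (hε1 : ε ≤ 1)
    (hNM : Quantum.diamondNorm (N - M) ≤ ENNReal.ofReal ε)
    (n : ℕ) (φ : Matrix (A × (Fin n → A')) (A × (Fin n → A')) ℂ) (hφ : Quantum.IsState φ) :
    |Quantum.entropy (Quantum.idTensor A (Quantum.tensorPow n N) φ) -
        Quantum.entropy (Quantum.idTensor A (Quantum.tensorPow n M) φ)| ≤
      n * (4 * ε * Real.logb 2 (Fintype.card B) + 2 * Quantum.binaryEntropy ε) := by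
  have h := Quantum.abs_spectralEntropy_idTensor_tensorPow_sub_le hN hM
    (fun _ _ hX => Quantum.abs_spectralEntropy_idTensor_sub_le hN hM hε0 hε1 hNM hX) n hφ
  have hlog : 0 < Real.log 2 := Real.log_pos one_lt_two
  rw [Quantum.entropy_eq_spectralEntropy_div ((hN.tensorPow n).isState hφ).posSemidef.isHermitian,
    Quantum.entropy_eq_spectralEntropy_div ((hM.tensorPow n).isState hφ).posSemidef.isHermitian,
    ← sub_div, abs_div, abs_of_pos hlog, Quantum.binaryEntropy_eq_binEntropy_div, Real.logb]
  refine (div_le_div_of_nonneg_right h hlog.le).trans_eq ?_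
  ring
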